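/- Let $L \ge 1$. The \emph{roundabout model} is a ring of $L$ cells with a queue in front of each cell. Indices $i$ are read modulo $L$. Its parameters are $p_i \in [0,1)$ and $q_{ij} \in [0,1]$ for $i,j \in \{1,\dots,L\}$, with $\prod_{\ell=1}^L (1-q_{\ell j}) < 1$ for every $j$. A state gives for each $i$ the length of queue $i$ (a non-negative integer) and the state of cell $i$, which is $0$ if the cell is empty and $j \in \{1,\dots,L\}$ if it holds a vehicle that entered the ring from queue $j$ (a vehicle of type $j$). In each time step, all $i$ are updated simultaneously: if cell $i$ is empty and queue $i$ is not, one vehicle leaves queue $i$ and cell $i+1$ gets state $i$; if cell $i$ and queue $i$ are both empty, cell $i+1$ becomes empty; if cell $i$ is in state $j \ge 1$, then with probability $q_{ij}$ the vehicle leaves the system and cell $i+1$ becomes empty, and otherwise cell $i+1$ gets state $j$; in addition, a new vehicle arrives at queue $i$ with probability $p_i$. All these random decisions are independent of each other and of the past. The model is \emph{stable} if this Markov chain is positive recurrent, that is, if every state that can be reached from the empty state has finite expected return time. Let $T_j$ be the time that a type-$j$ vehicle spends on the ring: $\mathbb{P}(T_j = k) = q_{j+k,j}\prod_{\ell=j+1}^{j+k-1}(1-q_{\ell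 j})$ for $k \ge 1$ and $\mathbb{P}(T_j=0)=0$. Let $N_{ij}$ be the number of $m \in \{1,\dots,T_j\}$ with $j+m \equiv i \pmod L$, that is, the number of times that such a vehicle occupies cell $i$, and let $b_{ij} := \mathbb{E} N_{ij}$ (which is finite). Put \[ \pi_{ij} := b_{ij}\, p_j \quad (1 \le j \le L), \qquad \pi_{i0} := 1 - \sum_{j=1}^L b_{ij}\, p_j . \] \textbf{Proposition.} If the roundabout model is stable, then the Markov chain has a unique stationary distribution, and for all $i \in \{1,\dots,L\}$ and $j \in \{0,1,\dots,L\}$ the probability under this distribution that cell $i$ is in state $j$ equals $\pi_{ij}$. -/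

import Mathlib

open scoped ENNReal

namespace Roundabout

/-- Parameters of a roundabout with `L` cells, the cells being indexed cyclically by `ZMod L`:
`p i` is the arrival probability at queue `i`, and `q i j` is the probability that a vehicle of
type `j` (one that entered from queue `j`) which occupies cell `i` leaves the system from there. -/
structure Params (L : ℕ) [NeZero L] where
  p : ZMod L → ℝ
  q : ZMod L → ZMod L → ℝ
  p_nonneg : ∀ i, 0 ≤ p i
  p_lt_one : ∀ i, p i < 1
  q_nonneg : ∀ i j, 0 ≤ q i j
  q_le_one : ∀ i j, q i j ≤ 1
  prod_stay_lt_one : ∀ j, ∏ l, (1 - q l j) < 1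

/-- A state gives, for every `i`, the length of queue `i` and the state of cell `i`: `none` if the
cell is empty, `some j` if it is occupied by a vehicle of type `j`. -/
abbrev State (L : ℕ) : Type := ZMod L → ℕ × Option (ZMod L)

/-- The state in which all queues and all cells are empty. -/
def emptyState (L : ℕ) : State L := fun _ => (0, none)

/-- The decisions taken in one time step: `e i none` tells whether a vehicle arrives at queue `i`,
and `e i (some j)` whether a vehicle of type `j`, if present in cell `i`, leaves the system. -/
abbrev Decisions (L : ℕ) : Type := ZMod L → Option (ZMod L) → Bool

/-- The new length of queue `i`: a waiting vehicle enters the ring if cell `i` is empty,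
and a new vehicle may arrive. -/
def nextQueue {L : ℕ} (x : State L) (e : Decisions L) (i : ZMod L) : ℕ :=
  (if (x i).2 = none then (x i).1 - 1 else (x i).1) + (if e i none then 1 else 0)

/-- The new state of cell `i + 1`, determined by the current states of queue `i` and cell `i`. -/
def nextCell {L : ℕ} (x : State L) (e : Decisions L) (i : ZMod L) : Option (ZMod L) :=
  match (x i).2 with
  | none => if 0 < (x i).1 then some i else none
  | some j => if e i (some j) then none else some j

/-- The update rule of the roundabout: cell `i` is updated from cell and queue `i - 1`. -/
def step {L : ℕ} (x : State L) (e : Decisions L) : State L :=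
  fun i => (nextQueue x e i, nextCell x e (i - 1))

/-- The path of the chain that starts in `x` and is driven by the decisions `ω 0, ω 1, …`. -/
def path {L : ℕ} (x : State L) (ω : ℕ → Decisions L) : ℕ → State L
  | 0 => x
  | t + 1 => step (path x ω t) (ω t)

/-- The first time `t ≥ 1` at which the path that starts in `x` is in `x` again (`∞` if there is
no such time). -/
noncomputable def returnTime {L : ℕ} (x : State L) (ω : ℕ → Decisions L) : ℝ≥0∞ :=
  ⨅ (t : ℕ) (_ : 1 ≤ t ∧ path x ω t = x), (t : ℝ≥0∞)

/-- For a vehicle of type `j` that spends `k` time units on the ring, and so occupies the cells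
`j + 1, …, j + k` successively, the number of times that it occupies cell `i`. -/
def visits {L : ℕ} (i j : ZMod L) (k : ℕ) : ℕ :=
  ((Finset.Icc 1 k).filter fun m : ℕ => j + (m : ZMod L) = i).card

namespace Params

variable {L : ℕ} [NeZero L] (M : Params L)

/-- The probability that the decision with index `(i, o)` is positive: `p i` for an arrival at
queue `i`, and `q i j` for a departure of type `j` from cell `i`. -/
def decisionProb (i : ZMod L) : Option (ZMod L) → unitInterval
  | none => ⟨M.p i, M.p_nonneg i, (M.p_lt_one i).le⟩
  | some j => ⟨M.q i j, M.q_nonneg i j, M.q_le_one i j⟩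

/-- The law of the decisions in one time step, which are independent of each other. -/
noncomputable def decisionLaw : MeasureTheory.Measure (Decisions L) :=
  MeasureTheory.Measure.pi fun i => MeasureTheory.Measure.pi fun o =>
    ProbabilityTheory.bernoulliMeasure true false (M.decisionProb i o)

instance : MeasureTheory.IsProbabilityMeasure M.decisionLaw := by
  unfold decisionLaw; infer_instance

/-- The law of the sequence of decisions, which are independent over time. -/
noncomputable def decisionsLaw : MeasureTheory.Measure (ℕ → Decisions L) :=
  MeasureTheory.Measure.infinitePi fun _ => M.decisionLaw

/-- The one-step transition probabilities of the chain. -/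
noncomputable def transProb (x y : State L) : ℝ≥0∞ :=
  M.decisionLaw {e | step x e = y}

/-- `x` can be reached from the empty state. -/
def Reachable (x : State L) : Prop :=
  Relation.ReflTransGen (fun y z => 0 < M.transProb y z) (emptyState L) x

/-- Stability is positive recurrence of the chain (on the set of states that can be reached from
the empty state, which is where the chain is irreducible): the expected return time of every such
state is finite. -/
def IsStable : Prop :=
  ∀ x, M.Reachable x → ∫⁻ ω, returnTime x ω ∂M.decisionsLaw < ∞

/-- `μ` is a stationary distribution of the chain. -/
def IsStationary (μ : PMF (State L)) : Prop :=
  ∀ y, ∑' x, μ x * M.transProb x y = μ y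

/-- The probability `∏_{ℓ = j+1}^{j+k} (1 - q ℓ j)` that a vehicle of type `j` does not leave from
any of the first `k` cells it occupies. -/
noncomputable def survProb (j : ZMod L) (k : ℕ) : ℝ :=
  ∏ m ∈ Finset.Icc 1 k, (1 - M.q (j + (m : ZMod L)) j)

/-- The probability that a vehicle of type `j` spends exactly `k` time units on the ring. -/
noncomputable def timeProb (j : ZMod L) : ℕ → ℝ
  | 0 => 0
  | k + 1 => M.survProb j k * M.q (j + ((k + 1 : ℕ) : ZMod L)) j

lemma survProb_zero (j : ZMod L) : M.survProb j 0 = 1 := by simp [survProb]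

lemma survProb_succ (j : ZMod L) (k : ℕ) :
    M.survProb j (k + 1) = M.survProb j k * (1 - M.q (j + ((k + 1 : ℕ) : ZMod L)) j) := by
  rw [survProb, survProb, Finset.prod_Icc_succ_top (by omega)]

lemma survProb_nonneg (j : ZMod L) (k : ℕ) : 0 ≤ M.survProb j k :=
  Finset.prod_nonneg fun _ _ => sub_nonneg.2 (M.q_le_one _ _)

lemma survProb_le_one (j : ZMod L) (k : ℕ) : M.survProb j k ≤ 1 :=
  Finset.prod_le_one (fun _ _ => sub_nonneg.2 (M.q_le_one _ _))
    fun m _ => by linarith [M.q_nonneg (j + (m : ZMod L)) j]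

lemma timeProb_succ (j : ZMod L) (k : ℕ) :
    M.timeProb j (k + 1) = M.survProb j k - M.survProb j (k + 1) := by
  rw [survProb_succ, timeProb]; ring

lemma timeProb_nonneg (j : ZMod L) (k : ℕ) : 0 ≤ M.timeProb j k := by
  cases k with
  | zero => exact le_rfl
  | succ k => exact mul_nonneg (M.survProb_nonneg j k) (M.q_nonneg _ _)

lemma prod_range_zmod (f : ZMod L → ℝ) (a : ZMod L) :
    ∏ m ∈ Finset.range L, f (a + (m : ZMod L)) = ∏ x, f x := by
  rw [← Equiv.prod_comp (Equiv.addLeft a) f]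
  refine Finset.prod_bij (fun m _ => (m : ZMod L)) (by simp) ?_ ?_ (by simp)
  · intro m hm n hn h
    rw [← ZMod.val_cast_of_lt (Finset.mem_range.1 hm), h, ZMod.val_cast_of_lt (Finset.mem_range.1 hn)]
  · intro b _
    exact ⟨b.val, Finset.mem_range.2 (ZMod.val_lt b), ZMod.natCast_zmod_val b⟩

lemma survProb_add_period (j : ZMod L) (k : ℕ) :
    M.survProb j (k + L) = M.survProb j k * ∏ l, (1 - M.q l j) := by
  have h : ∀ n, M.survProb j (k + n) = M.survProb j k *
      ∏ m ∈ Finset.range n, (1 - M.q ((j + ((k + 1 : ℕ) : ZMod L)) + (m : ZMod L)) j) := by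
    intro n
    induction n with
    | zero => simp
    | succ n ih =>
      rw [← add_assoc, survProb_succ, ih, Finset.prod_range_succ, mul_assoc]
      have : j + ((k + n + 1 : ℕ) : ZMod L) = j + ((k + 1 : ℕ) : ZMod L) + (n : ZMod L) := by
        push_cast; ring
      rw [this]
  rw [h L, prod_range_zmod (fun x => 1 - M.q x j)]

lemma summable_survProb (j : ZMod L) : Summable (M.survProb j) := by
  set r : ℝ := ∏ l, (1 - M.q l j) with hr
  have hr0 : 0 ≤ r := Finset.prod_nonneg fun _ _ => sub_nonneg.2 (M.q_le_one _ _)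
  have hmul : ∀ n k, M.survProb j (k + n * L) = M.survProb j k * r ^ n := by
    intro n k
    induction n with
    | zero => simp
    | succ n ih => rw [Nat.succ_mul, ← add_assoc, survProb_add_period, ih, pow_succ, mul_assoc]
  rw [← (Nat.divModEquiv L).symm.summable_iff]
  have hs : Summable fun x : ℕ × Fin L => r ^ x.1 * (1 : ℝ) :=
    (summable_geometric_of_lt_one hr0 (M.prod_stay_lt_one j)).mul_of_nonneg
      (g := fun _ : Fin L => (1 : ℝ)) (Summable.of_finite) (fun n => pow_nonneg hr0 n)
      (fun _ => zero_le_one)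
  refine Summable.of_nonneg_of_le (fun x => M.survProb_nonneg j _) (fun x => ?_) hs
  have : (Nat.divModEquiv L).symm x = (x.2 : ℕ) + x.1 * L := by
    simp [Nat.divModEquiv, add_comm, mul_comm]
  rw [Function.comp_apply, this, hmul, mul_comm]
  exact mul_le_mul_of_nonneg_left (M.survProb_le_one j _) (pow_nonneg hr0 _)

lemma hasSum_timeProb (j : ZMod L) : HasSum (M.timeProb j) 1 := by
  rw [hasSum_iff_tendsto_nat_of_nonneg (M.timeProb_nonneg j)]
  rw [← Filter.tendsto_add_atTop_iff_nat 1]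
  have h : ∀ n, ∑ k ∈ Finset.range (n + 1), M.timeProb j k = 1 - M.survProb j n := by
    intro n
    induction n with
    | zero => simp [timeProb, survProb_zero]
    | succ n ih => rw [Finset.sum_range_succ, ih, timeProb_succ]; ring
  simp only [h]
  simpa using tendsto_const_nhds.sub (M.summable_survProb j).tendsto_atTop_zero

/-- The law of the time `T_j` that a vehicle of type `j` spends on the ring. -/
noncomputable def timeLaw (j : ZMod L) : PMF ℕ :=
  ⟨fun k => ENNReal.ofReal (M.timeProb j k), by
    have h := ENNReal.ofReal_tsum_of_nonneg (M.timeProb_nonneg j) (M.hasSum_timeProb j).summable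
    rw [(M.hasSum_timeProb j).tsum_eq, ENNReal.ofReal_one] at h
    exact h ▸ ENNReal.summable.hasSum⟩

/-- `b i j`, the expected number of times that a vehicle of type `j` occupies cell `i` during the
time `T_j` it spends on the ring. -/
noncomputable def expectedVisits (i j : ZMod L) : ℝ :=
  ∑' k, (M.timeLaw j k).toReal * (visits i j k : ℝ)

/-- The expectation that defines `expectedVisits` is finite. -/
lemma summable_expectedVisits (i j : ZMod L) :
    Summable fun k => (M.timeLaw j k).toReal * (visits i j k : ℝ) := by
  have hT : ∀ k, (M.timeLaw j k).toReal = M.timeProb j k := fun k =>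
    ENNReal.toReal_ofReal (M.timeProb_nonneg j k)
  have hk : Summable fun k : ℕ => M.timeProb j k * (k : ℝ) := by
    rw [← summable_nat_add_iff 1]
    have h : ∀ n : ℕ, ∑ k ∈ Finset.range n, M.timeProb j (k + 1) * ((k + 1 : ℕ) : ℝ) =
        ∑ k ∈ Finset.range n, M.survProb j k - n * M.survProb j n := by
      intro n
      induction n with
      | zero => simp
      | succ n ih =>
        rw [Finset.sum_range_succ, Finset.sum_range_succ, ih, timeProb_succ]
        push_cast; ring
    refine summable_of_sum_range_le (c := ∑' k, M.survProb j k)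
      (fun k => mul_nonneg (M.timeProb_nonneg j _) (Nat.cast_nonneg _)) fun n => ?_
    rw [h]
    have h1 := (M.summable_survProb j).sum_le_tsum (Finset.range n)
      fun k _ => M.survProb_nonneg j k
    have h2 := mul_nonneg (Nat.cast_nonneg (α := ℝ) n) (M.survProb_nonneg j n)
    linarith
  refine Summable.of_nonneg_of_le
    (fun k => mul_nonneg ENNReal.toReal_nonneg (Nat.cast_nonneg _)) (fun k => ?_) hk
  rw [hT]
  refine mul_le_mul_of_nonneg_left ?_ (M.timeProb_nonneg j k)
  exact_mod_cast (Finset.card_filter_le _ _).trans (by simp)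

/-- The numbers `π i s`: `b i j * p j` for an occupied cell, `1 - ∑ j, b i j * p j` for an
empty one. -/
noncomputable def load (i : ZMod L) : Option (ZMod L) → ℝ
  | none => 1 - ∑ j, M.expectedVisits i j * M.p j
  | some j => M.expectedVisits i j * M.p j

end Params

end Roundabout

/-! Existence: the expected occupation measure of an excursion from the empty state back to itself
is invariant, and it is finite because the mean return time of the empty state is. This is the only
use of stability (`exists_invariant_PMF`). Uniqueness: from every state the empty state is reached
with positive probability, by having no arrivals and letting every vehicle leave where it can
(`leads_emptyState`). Two invariant laws are then compared through their pointwise minimum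
(`Invariant.le_of_le_at`). Marginals: stationarity says that the expectation of a test function is
unchanged by one step. Applied to a truncated queue length, it shows that vehicles enter from queue
`i` at rate `p i` (`tsum_entering`). Applied to the indicator that cell `i + 1` holds type `j`, it
gives a linear recursion around the ring (`tsum_cellIs_succ`). The numbers `b i j * p j` satisfy the
same recursion (`expectedVisits_succ`), and its solution is unique because one turn around the ring
contracts by `∏ l, (1 - q l j) < 1` (`eq_zero_of_succ_eq`). The empty cell takes the remaining mass.
-/

namespace Roundabout

/-! ### Invariant measures of stochastic matrices -/

section Chain

variable {S : Type*} {P : S → S → ℝ≥0∞}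

lemma tsum_tsum_mul_of_stochastic (hP : ∀ x, ∑' y, P x y = 1) (m : S → ℝ≥0∞) :
    ∑' y, ∑' x, m x * P x y = ∑' x, m x := by
  rw [ENNReal.tsum_comm]
  simp [ENNReal.tsum_mul_left, hP]

lemma eq_of_le_of_tsum_eq {f g : S → ℝ≥0∞} (hfg : f ≤ g) (hf : ∑' x, f x ≠ ∞)
    (h : ∑' x, f x = ∑' x, g x) : f = g := by
  by_contra hne
  obtain ⟨i, hi⟩ := Function.ne_iff.1 hne
  exact (ENNReal.tsum_lt_tsum hf hfg (lt_of_le_of_ne (hfg i) hi)).ne h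

/-- `m` is an invariant measure of the transition matrix `P`. -/
def Invariant (P : S → S → ℝ≥0∞) (m : S → ℝ≥0∞) : Prop :=
  ∀ y, ∑' x, m x * P x y = m y

/-- `y` can be reached from `x` with positive probability. -/
def Leads (P : S → S → ℝ≥0∞) : S → S → Prop :=
  Relation.ReflTransGen fun y z => 0 < P y z

/-- A stochastic matrix preserves total mass, so for a finite measure a pointwise inequality between
`m P` and `m` cannot be strict anywhere. -/
lemma Invariant.of_le {m : S → ℝ≥0∞} (hP : ∀ x, ∑' y, P x y = 1)
    (hfin : ∑' x, m x ≠ ∞) (h : ∀ y, ∑' x, m x * P x y ≤ m y) : Invariant P m := by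
  intro y
  have hs := tsum_tsum_mul_of_stochastic hP m
  exact congrFun (eq_of_le_of_tsum_eq (f := fun y => ∑' x, m x * P x y) h (hs ▸ hfin) hs) y

lemma Invariant.pos_of_leads {m : S → ℝ≥0∞} (hm : Invariant P m) {x y : S}
    (hxy : Leads P x y) (hx : 0 < m x) : 0 < m y := by
  induction hxy with
  | refl => exact hx
  | @tail b c _ hbc ih =>
    rw [← hm c]
    exact (ENNReal.mul_pos ih.ne' hbc.ne').trans_le (ENNReal.le_tsum b)

/-- The minimum of `m` and `n` is subinvariant and finite, hence invariant, and so is its difference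
from `m`. That difference vanishes at `a`; if it were positive at some `x`, its mass would flow
along a path from `x` to `a`. -/
lemma Invariant.le_of_le_at {m n : S → ℝ≥0∞} (hP : ∀ x, ∑' y, P x y = 1)
    (hm : Invariant P m) (hn : Invariant P n) (hfin : ∑' x, m x ≠ ∞) {a : S}
    (ha : ∀ x, Leads P x a) (hle : m a ≤ n a) : m ≤ n := by
  set k : S → ℝ≥0∞ := fun x => min (m x) (n x) with hk
  have hkm : ∀ x, k x ≤ m x := fun x => min_le_left _ _
  have hkfin : ∑' x, k x ≠ ∞ := ne_top_of_le_ne_top hfin (ENNReal.tsum_le_tsum hkm)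
  have hkinv : Invariant P k := by
    refine .of_le hP hkfin fun y => le_min ?_ ?_
    · exact (ENNReal.tsum_le_tsum fun x => mul_le_mul_left (min_le_left _ _) _).trans_eq (hm y)
    · exact (ENNReal.tsum_le_tsum fun x => mul_le_mul_left (min_le_right _ _) _).trans_eq (hn y)
  have hsum : ∀ x, m x = (m x - k x) + k x := fun x => (tsub_add_cancel_of_le (hkm x)).symm
  have hd : Invariant P fun x => m x - k x := by
    intro y
    have h1 := hm y
    simp_rw [fun x => congrArg (· * P x y) (hsum x), add_mul] at h1
    rw [ENNReal.tsum_add, hkinv y, hsum y] at h1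
    exact (ENNReal.add_left_inj (ne_top_of_le_ne_top hkfin (ENNReal.le_tsum y))).1 h1
  intro x
  by_contra hx
  have hpos : 0 < m x - k x :=
    tsub_pos_of_lt ((min_le_right _ _).trans_lt (not_le.1 hx))
  have := hd.pos_of_leads (ha x) hpos
  simp [hk, hle] at this

lemma PMF_eq_of_invariant (hP : ∀ x, ∑' y, P x y = 1) {a : S} (ha : ∀ x, Leads P x a)
    {m n : PMF S} (hm : Invariant P m) (hn : Invariant P n) : m = n := by
  wlog h : m a ≤ n a generalizing m n
  · exact (this hn hm (le_of_not_ge h)).symm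
  refine DFunLike.coe_injective (eq_of_le_of_tsum_eq
    (hm.le_of_le_at hP hn m.tsum_coe_ne_top ha h) m.tsum_coe_ne_top ?_)
  rw [m.tsum_coe, n.tsum_coe]

/-- A taboo decomposition: if `u t` is the law at time `t` of a chain started in `a` and killed when
it returns to `a`, and the expected killing time is finite, then there is an invariant law. -/
lemma exists_invariant_PMF (hP : ∀ x, ∑' y, P x y = 1) {a : S} {u : ℕ → S → ℝ≥0∞}
    (ha : u 0 a = 1) (h0 : ∀ y, y ≠ a → u 0 y = 0)
    (hsucc : ∀ t y, y ≠ a → u (t + 1) y = ∑' x, u t x * P x y)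
    (hsucca : ∀ t, u (t + 1) a = 0) (hfin : ∑' t, ∑' x, u t x ≠ ∞) :
    ∃ m : PMF S, Invariant P m := by
  set v : S → ℝ≥0∞ := fun x => ∑' t, u t x with hv
  have hva : v a = 1 := by
    rw [hv]
    dsimp only
    rw [tsum_eq_zero_add' ENNReal.summable, ha]
    simp [hsucca]
  have hvfin : ∑' x, v x ≠ ∞ := by rwa [hv, ENNReal.tsum_comm]
  have hvpos : ∑' x, v x ≠ 0 := fun h => by
    rw [ENNReal.tsum_eq_zero.1 h a] at hva
    exact zero_ne_one hva
  have hy : ∀ y, y ≠ a → ∑' x, v x * P x y = v y := by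
    intro y hya
    simp_rw [hv, ← ENNReal.tsum_mul_right]
    rw [ENNReal.tsum_comm, tsum_eq_zero_add' (f := fun t => u t y) ENNReal.summable, h0 y hya,
      zero_add]
    exact tsum_congr fun t => (hsucc t y hya).symm
  have hs := tsum_tsum_mul_of_stochastic hP v
  have hinv : Invariant P v := by
    -- The mass returning to `a` need not be computed: `v P` and `v` agree off `a` and have the same
    -- finite total mass, so whichever inequality holds at `a` is an equality.
    rcases le_total (∑' x, v x * P x a) (v a) with h | h
    · refine .of_le hP hvfin fun y => ?_
      by_cases hya : y = a
      · exact hya ▸ h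
      · exact (hy y hya).le
    · refine fun y => (congrFun (eq_of_le_of_tsum_eq (f := v)
        (g := fun y => ∑' x, v x * P x y) (fun y => ?_) hvfin hs.symm) y).symm
      by_cases hya : y = a
      · exact hya ▸ h
      · exact (hy y hya).ge
  refine ⟨PMF.normalize v hvpos hvfin, fun y => ?_⟩
  simp_rw [PMF.normalize_apply, mul_right_comm, ENNReal.tsum_mul_right, hinv y]

end Chain

/-! ### The one-step law of the roundabout -/

open MeasureTheory

instance {L : ℕ} [NeZero L] : Countable (State L) := by
  unfold State; infer_instance

namespace Params

variable {L : ℕ} [NeZero L] (M : Params L)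

lemma measurableSet_decisions (s : Set (Decisions L)) : MeasurableSet s :=
  s.toFinite.measurableSet

lemma decisionLaw_singleton (e : Decisions L) :
    M.decisionLaw {e} = ∏ i, ∏ o, ProbabilityTheory.bernoulliMeasure true false
      (M.decisionProb i o) {e i o} := by
  rw [decisionLaw, Measure.pi_singleton]
  simp_rw [Measure.pi_singleton]

lemma decisionLaw_eval (i : ZMod L) (o : Option (ZMod L)) (b : Bool) :
    M.decisionLaw {e | e i o = b} =
      ProbabilityTheory.bernoulliMeasure true false (M.decisionProb i o) {b} := by
  have h1 : MeasurePreserving (Function.eval i) M.decisionLaw _ :=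
    measurePreserving_eval (fun i => Measure.pi fun o =>
      ProbabilityTheory.bernoulliMeasure true false (M.decisionProb i o)) i
  have h2 : MeasurePreserving (Function.eval o) _ _ := measurePreserving_eval
    (fun o => ProbabilityTheory.bernoulliMeasure true false (M.decisionProb i o)) o
  exact (h2.comp h1).measure_preimage (measurableSet_singleton b).nullMeasurableSet

lemma decisionLaw_arrival (i : ZMod L) :
    M.decisionLaw {e | e i none = true} = ENNReal.ofReal (M.p i) := by
  rw [decisionLaw_eval, ProbabilityTheory.bernoulliMeasure_apply_of_mem_of_notMem _ (by simp)
    (by simp) (by simp)]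
  exact (ENNReal.ofReal_eq_coe_nnreal (M.p_nonneg i)).symm

lemma decisionLaw_stay (i j : ZMod L) :
    M.decisionLaw {e | e i (some j) = false} = ENNReal.ofReal (1 - M.q i j) := by
  rw [decisionLaw_eval, ProbabilityTheory.bernoulliMeasure_apply_of_notMem_of_mem _ (by simp)
    (by simp) (by simp)]
  exact (ENNReal.ofReal_eq_coe_nnreal (sub_nonneg.2 (M.q_le_one i j))).symm

/-- Integrating a function over one step of the chain. -/
lemma tsum_transProb_mul (x : State L) (f : State L → ℝ≥0∞) :
    ∑' y, M.transProb x y * f y = ∫⁻ e, f (step x e) ∂M.decisionLaw := by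
  let _ : MeasurableSpace (State L) := ⊤
  have hm : Measurable fun e : Decisions L => step x e := fun s _ => measurableSet_decisions _
  have hf : Measurable f := fun s _ => trivial
  rw [← lintegral_map hf hm, lintegral_countable']
  refine tsum_congr fun y => ?_
  rw [Measure.map_apply hm trivial, mul_comm]
  rfl

lemma tsum_transProb (x : State L) : ∑' y, M.transProb x y = 1 := by
  have := M.tsum_transProb_mul x fun _ => 1
  simpa using this

/-- Stationarity in the form used for all balance equations: a test function has the same
expectation before and after a step. Values in `ℝ≥0∞` make integrability irrelevant. -/
lemma tsum_mul_of_invariant {m : State L → ℝ≥0∞} (hm : Invariant M.transProb m)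
    (f : State L → ℝ≥0∞) :
    ∑' y, m y * f y = ∑' x, m x * ∫⁻ e, f (step x e) ∂M.decisionLaw := by
  calc ∑' y, m y * f y = ∑' y, ∑' x, m x * M.transProb x y * f y :=
        tsum_congr fun y => by rw [ENNReal.tsum_mul_right, hm y]
    _ = ∑' x, m x * ∑' y, M.transProb x y * f y := by
        rw [ENNReal.tsum_comm]
        simp_rw [mul_assoc, ENNReal.tsum_mul_left]
    _ = _ := by simp_rw [tsum_transProb_mul]

/-! ### The empty state can be reached from every state -/

lemma bernoulli_pos {p : unitInterval} {b : Bool} (h1 : b = true → 0 < (p : ℝ))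
    (h2 : b = false → (p : ℝ) < 1) :
    0 < ProbabilityTheory.bernoulliMeasure true false p {b} := by
  cases b
  · rw [ProbabilityTheory.bernoulliMeasure_apply_of_notMem_of_mem _ (by simp)
      (by simp) (by simp)]
    rw [ENNReal.coe_pos, ← NNReal.coe_pos]
    simpa using h2 rfl
  · rw [ProbabilityTheory.bernoulliMeasure_apply_of_mem_of_notMem _ (by simp)
      (by simp) (by simp)]
    rw [ENNReal.coe_pos, ← NNReal.coe_pos]
    simpa using h1 rfl

open Classical in
/-- The decisions in which no vehicle arrives and every vehicle leaves as soon as it can. -/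
noncomputable def drain : Decisions L
  | _, none => false
  | i, some j => decide (0 < M.q i j)

lemma transProb_drain_pos (x : State L) : 0 < M.transProb x (step x M.drain) := by
  have h : 0 < M.decisionLaw {M.drain} := by
    rw [decisionLaw_singleton]
    refine (pos_iff_ne_zero).2 (Finset.prod_ne_zero_iff.2 fun i _ =>
      Finset.prod_ne_zero_iff.2 fun o _ => (bernoulli_pos ?_ ?_).ne')
    · cases o with
      | none => simp [drain]
      | some j => simp [drain, decisionProb]
    · cases o with
      | none => simpa [drain, decisionProb] using M.p_lt_one i
      | some j =>
        intro h
        simp only [drain, decide_eq_false_iff_not, not_lt] at h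
        exact h.trans_lt one_pos
  refine h.trans_le (measure_mono ?_)
  rintro _ rfl
  rfl

/-- The number of vehicles in the system. -/
def vehicles (x : State L) : ℕ := ∑ i, ((x i).1 + if (x i).2 = none then 0 else 1)

/-- Without arrivals the number of vehicles changes only by departures, which the second sum counts;
entering the ring moves a vehicle from queue to cell. -/
lemma vehicles_step_drain (x : State L) :
    vehicles (step x M.drain) + (∑ i, if ∃ j, (x i).2 = some j ∧ 0 < M.q i j then 1 else 0) =
      vehicles x := by
  -- The new state of cell `i + 1` is accounted for at index `i`, so that the identity can be
  -- checked summand by summand.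
  have hc : (∑ i, if (step x M.drain i).2 = none then 0 else 1) =
      ∑ i, if nextCell x M.drain i = none then 0 else 1 :=
    (Equiv.subRight (1 : ZMod L)).sum_comp fun i => if nextCell x M.drain i = none then 0 else 1
  unfold vehicles
  rw [Finset.sum_add_distrib, hc, ← Finset.sum_add_distrib, ← Finset.sum_add_distrib]
  refine Finset.sum_congr rfl fun i _ => ?_
  change nextQueue x M.drain i + _ + _ = _
  rcases hx : x i with ⟨n, _ | j⟩
  · rcases n with _ | n <;> simp [nextQueue, nextCell, hx, drain]
  · by_cases hq : 0 < M.q i j <;> simp [nextQueue, nextCell, hx, drain, hq]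

/-- The state after `t` steps under the draining decisions. -/
noncomputable def drained (x : State L) (t : ℕ) : State L := (fun y => step y M.drain)^[t] x

lemma drained_succ (x : State L) (t : ℕ) :
    M.drained x (t + 1) = step (M.drained x t) M.drain :=
  Function.iterate_succ_apply' _ _ _

lemma leads_drained (x : State L) (t : ℕ) : Leads M.transProb x (M.drained x t) := by
  induction t with
  | zero => exact .refl
  | succ t ih => exact ih.tail (by rw [drained_succ]; exact M.transProb_drain_pos _)

lemma exists_q_pos (i j : ZMod L) : ∃ t : ℕ, 0 < M.q (i + t) j := by
  by_contra! h
  have h0 : ∀ l, 1 - M.q l j = 1 := fun l => by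
    have := h (l - i).val
    rw [ZMod.natCast_zmod_val, add_sub_cancel] at this
    linarith [M.q_nonneg l j]
  have := M.prod_stay_lt_one j
  simp [h0] at this

/-- If no vehicle ever leaves, a vehicle on the ring would travel on until it meets a cell with
positive exit probability, where draining removes it. So the ring stays empty, which forces the
queues to be empty too. -/
lemma eq_emptyState_of_vehicles_drained {x : State L}
    (h : ∀ t, vehicles (M.drained x t) = vehicles x) : x = emptyState L := by
  have hstay : ∀ t i j, (M.drained x t i).2 = some j → ¬ 0 < M.q i j := by
    intro t i j hij hq
    have h1 := M.vehicles_step_drain (M.drained x t)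
    rw [← drained_succ, h, h, add_eq_left, Finset.sum_eq_zero_iff] at h1
    have := h1 i (Finset.mem_univ i)
    rw [if_pos ⟨j, hij, hq⟩] at this
    exact one_ne_zero this
  have hmove : ∀ s t i j, (M.drained x s i).2 = some j →
      (M.drained x (s + t) (i + (t : ℕ))).2 = some j := by
    intro s t i j hij
    induction t with
    | zero => simpa using hij
    | succ t ih =>
      have hq := hstay _ _ _ ih
      rw [← add_assoc, drained_succ]
      simp only [step, nextCell, Nat.cast_add, Nat.cast_one, ← add_assoc, add_sub_cancel_right]
      simp [ih, drain, hq]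
  have hnone : ∀ s i, (M.drained x s i).2 = none := by
    intro s i
    by_contra hne
    obtain ⟨j, hj⟩ := Option.ne_none_iff_exists'.1 hne
    obtain ⟨t, ht⟩ := M.exists_q_pos i j
    exact hstay _ _ _ (hmove s t i j hj) ht
  -- A vehicle waiting in front of the empty cell `i` would occupy cell `i + 1` at time `1`.
  funext i
  have h0 : (x i).2 = none := hnone 0 i
  have h1 := hnone 1 (i + 1)
  rw [drained_succ] at h1
  simp only [drained, Function.iterate_zero, id, step, nextCell, add_sub_cancel_right, h0] at h1
  refine Prod.ext ?_ h0
  by_contra hq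
  simp [Nat.pos_of_ne_zero hq] at h1

lemma leads_emptyState (x : State L) : Leads M.transProb x (emptyState L) := by
  obtain ⟨n, hn⟩ : ∃ n, vehicles x = n := ⟨_, rfl⟩
  induction n using Nat.strong_induction_on generalizing x with
  | _ n ih =>
    by_cases h : ∀ t, vehicles (M.drained x t) = vehicles x
    · rw [M.eq_emptyState_of_vehicles_drained h]
      exact .refl
    · push Not at h
      obtain ⟨t, ht⟩ := h
      have hle : vehicles (M.drained x t) ≤ vehicles x := by
        clear ht
        induction t with
        | zero => exact le_rfl
        | succ t iht =>
          rw [drained_succ]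
          exact (Nat.le_of_add_right_le (M.vehicles_step_drain _).le).trans iht
      exact (M.leads_drained x t).trans (ih _ (hn ▸ lt_of_le_of_ne hle ht) _ rfl)

end Params

/-! ### Excursions and the return time -/

lemma path_congr {L : ℕ} (x : State L) {ω ω' : ℕ → Decisions L} {t : ℕ}
    (h : ∀ s < t, ω s = ω' s) : path x ω t = path x ω' t := by
  induction t with
  | zero => rfl
  | succ t ih =>
    rw [path, path, ih fun s hs => h s (hs.trans t.lt_succ_self), h t t.lt_succ_self]

/-- The decisions for which the path that starts in `x` has not returned to `x` by time `t`. -/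
def noReturn {L : ℕ} (x : State L) (t : ℕ) : Set (ℕ → Decisions L) :=
  {ω | ∀ s, 1 ≤ s → s ≤ t → path x ω s ≠ x}

lemma noReturn_of_agree {L : ℕ} {x : State L} {t : ℕ} (ω ω' : ℕ → Decisions L)
    (h : ∀ s < t, ω s = ω' s) (hω : ω ∈ noReturn x t) : ω' ∈ noReturn x t := by
  intro s h1 h2
  rw [← path_congr x fun r hr => h r (hr.trans_le h2)]
  exact hω s h1 h2

/-- The event that the path from `x` is in `y` at time `t` and has not returned to `x` by then. -/
def tabooEvent {L : ℕ} (x : State L) (t : ℕ) (y : State L) : Set (ℕ → Decisions L) :=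
  noReturn x t ∩ {ω | path x ω t = y}

lemma tabooEvent_of_agree {L : ℕ} {x y : State L} {t : ℕ} (ω ω' : ℕ → Decisions L)
    (h : ∀ s < t, ω s = ω' s) (hω : ω ∈ tabooEvent x t y) : ω' ∈ tabooEvent x t y :=
  ⟨noReturn_of_agree ω ω' h hω.1, (path_congr x h).symm.trans hω.2⟩

/-- If the path is back in `x` at a time `t ≥ 1`, only the terms with index below `t` can be
nonzero, and each is at most `1`. -/
lemma tsum_indicator_noReturn_le {L : ℕ} (x : State L) (ω : ℕ → Decisions L) :
    ∑' t, (noReturn x t).indicator (fun _ => (1 : ℝ≥0∞)) ω ≤ returnTime x ω := by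
  refine le_iInf₂ fun t ht => ?_
  rw [tsum_eq_sum (s := Finset.range t)]
  · calc _ ≤ ∑ _s ∈ Finset.range t, (1 : ℝ≥0∞) :=
          Finset.sum_le_sum fun s _ => Set.indicator_le_self' (fun _ _ => zero_le) ω
      _ = t := by simp
  · intro s hs
    refine Set.indicator_of_notMem (fun h => ?_) _
    exact h t ht.1 (by simpa using hs) ht.2

namespace Params

variable {L : ℕ} [NeZero L] (M : Params L)

/-- An event that is determined by the decisions before time `t` is a preimage under the
restriction to these. -/
lemma exists_preimage_restrict {t : ℕ} {A : Set (ℕ → Decisions L)}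
    (hA : ∀ ω ω', (∀ s < t, ω s = ω' s) → ω ∈ A → ω' ∈ A) :
    ∃ B : Set (Finset.range t → Decisions L), MeasurableSet B ∧
      A = (Finset.range t).restrict (π := fun _ => Decisions L) ⁻¹' B := by
  refine ⟨(Finset.range t).restrict (π := fun _ => Decisions L) '' A,
    (Set.toFinite _).measurableSet, (Set.subset_preimage_image _ _).antisymm ?_⟩
  rintro ω ⟨ω', h', h⟩
  exact hA ω' ω (fun s hs => congrFun h ⟨s, Finset.mem_range.2 hs⟩) h'

lemma measurableSet_of_past {t : ℕ} {A : Set (ℕ → Decisions L)}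
    (hA : ∀ ω ω', (∀ s < t, ω s = ω' s) → ω ∈ A → ω' ∈ A) : MeasurableSet A := by
  obtain ⟨B, hB, rfl⟩ := exists_preimage_restrict hA
  exact Finset.measurable_restrict _ hB

/-- Independence of the past and the current decision; it supplies the Markov property for
`tabooEvent_succ`. -/
lemma decisionsLaw_inter {t : ℕ} {A : Set (ℕ → Decisions L)}
    (hA : ∀ ω ω', (∀ s < t, ω s = ω' s) → ω ∈ A → ω' ∈ A) (C : Set (Decisions L)) :
    M.decisionsLaw (A ∩ {ω | ω t ∈ C}) = M.decisionsLaw A * M.decisionLaw C := by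
  obtain ⟨B, hB, rfl⟩ := exists_preimage_restrict hA
  have hC := measurableSet_decisions C
  have hi : ProbabilityTheory.iIndepFun (fun (s : ℕ) (ω : ℕ → Decisions L) => ω s)
      M.decisionsLaw :=
    ProbabilityTheory.iIndepFun_infinitePi (P := fun _ : ℕ => M.decisionLaw)
      (X := fun _ e => e) fun _ => measurable_id
  have h2 := hi.indepFun_finset (Finset.range t) {t} (by simp) fun s => measurable_pi_apply s
  have h3 := (h2.comp measurable_id (measurable_pi_apply ⟨t, Finset.mem_singleton_self t⟩)
    ).measure_inter_preimage_eq_mul B C hB hC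
  refine h3.trans (congrArg _ ?_)
  exact (measurePreserving_eval_infinitePi (fun _ : ℕ => M.decisionLaw) t).measure_preimage
    hC.nullMeasurableSet

lemma tsum_tabooEvent (x : State L) (t : ℕ) :
    ∑' y, M.decisionsLaw (tabooEvent x t y) = M.decisionsLaw (noReturn x t) := by
  rw [← measure_iUnion]
  · congr 1
    ext ω
    simp [tabooEvent]
  · intro y z hyz
    refine Set.disjoint_left.2 fun ω h1 h2 => hyz (h1.2.symm.trans h2.2)
  · exact fun y => measurableSet_of_past tabooEvent_of_agree

/-- Split according to the position `z` at time `t`. As `y ≠ x`, being in `y` at time `t + 1` adds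
no return, so only the past up to `t` has to avoid `x`. -/
lemma tabooEvent_succ {x y : State L} (hy : y ≠ x) (t : ℕ) :
    M.decisionsLaw (tabooEvent x (t + 1) y) =
      ∑' z, M.decisionsLaw (tabooEvent x t z) * M.transProb z y := by
  have h : tabooEvent x (t + 1) y =
      ⋃ z, (tabooEvent x t z ∩ {ω | ω t ∈ {e | step z e = y}}) := by
    ext ω
    simp only [tabooEvent, Set.mem_inter_iff, Set.mem_ofPred_eq, Set.mem_iUnion, path]
    constructor
    · rintro ⟨h1, h2⟩
      exact ⟨_, ⟨fun s hs hst => h1 s hs (hst.trans t.le_succ), rfl⟩, h2⟩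
    · rintro ⟨z, ⟨h1, rfl⟩, h2⟩
      refine ⟨fun s hs hst => ?_, h2⟩
      rcases hst.lt_or_eq with h | rfl
      · exact h1 s hs (Nat.lt_succ_iff.1 h)
      · rw [path, h2]
        exact hy
  rw [h, measure_iUnion]
  · exact tsum_congr fun z => M.decisionsLaw_inter tabooEvent_of_agree _
  · intro z w hzw
    refine Set.disjoint_left.2 fun ω h1 h2 => hzw (h1.1.2.symm.trans h2.1.2)
  · intro z
    exact (measurableSet_of_past tabooEvent_of_agree).inter
      ((measurable_pi_apply t) (measurableSet_decisions _))

lemma tsum_noReturn_le (x : State L) :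
    ∑' t, M.decisionsLaw (noReturn x t) ≤ ∫⁻ ω, returnTime x ω ∂M.decisionsLaw := by
  refine le_trans (le_of_eq ?_) (lintegral_mono fun ω => tsum_indicator_noReturn_le x ω)
  have hm : ∀ t, MeasurableSet (noReturn (L := L) x t) := fun t =>
    measurableSet_of_past noReturn_of_agree
  rw [lintegral_tsum fun t => (measurable_const.indicator (hm t)).aemeasurable]
  exact tsum_congr fun t => (lintegral_indicator_one (hm t)).symm

lemma exists_invariant_of_returnTime {x : State L}
    (h : ∫⁻ ω, returnTime x ω ∂M.decisionsLaw < ∞) :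
    ∃ m : PMF (State L), Invariant M.transProb m := by
  have : IsProbabilityMeasure M.decisionsLaw := by unfold decisionsLaw; infer_instance
  refine exists_invariant_PMF (a := x) (u := fun t y => M.decisionsLaw (tabooEvent x t y))
    M.tsum_transProb ?_ ?_ (fun t y hy => M.tabooEvent_succ hy t) ?_ ?_
  · have : tabooEvent (L := L) x 0 x = Set.univ := by
      ext ω
      simp only [tabooEvent, noReturn, path, Set.mem_inter_iff, Set.mem_ofPred_eq, Set.mem_univ,
        and_true, iff_true]
      omega
    simp [this]
  · intro y hy
    have : tabooEvent (L := L) x 0 y = ∅ :=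
      Set.eq_empty_of_forall_notMem fun ω hω => hy hω.2.symm
    simp [this]
  · intro t
    have : tabooEvent (L := L) x (t + 1) x = ∅ :=
      Set.eq_empty_of_forall_notMem fun ω hω => hω.1 (t + 1) (by omega) le_rfl hω.2
    simp [this]
  · simp_rw [tsum_tabooEvent]
    exact ((M.tsum_noReturn_le x).trans_lt h).ne

theorem existsUnique_stationary (hM : M.IsStable) :
    ∃! μ : PMF (State L), M.IsStationary μ := by
  obtain ⟨m, hm⟩ := M.exists_invariant_of_returnTime (hM (emptyState L) .refl)
  exact ⟨m, hm, fun n hn => PMF_eq_of_invariant M.tsum_transProb M.leads_emptyState hn hm⟩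

end Params

/-! ### Balance of the flow of vehicles in a stationary regime -/

open Filter Topology

lemma PMF_tendsto_of_monotone {S : Type*} (m : PMF S) {A : ℕ → Set S} (hA : Monotone A) :
    Tendsto (fun n => ∑' x, (A n).indicator m x) atTop (𝓝 (∑' x, (⋃ n, A n).indicator m x)) := by
  let _ : MeasurableSpace S := ⊤
  have := tendsto_measure_iUnion_atTop (μ := m.toMeasure) hA
  simpa [Function.comp_def, PMF.toMeasure_apply] using this

/-- The length of queue `i` after a vehicle may have left it and before one may arrive. -/
def restQueue {L : ℕ} (x : State L) (i : ZMod L) : ℕ :=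
  if (x i).2 = none then (x i).1 - 1 else (x i).1

/-- The states in which a vehicle is about to enter the ring from queue `i`. -/
def entering {L : ℕ} (i : ZMod L) : Set (State L) := {x | (x i).2 = none ∧ 0 < (x i).1}

/-- The states in which cell `i` is in state `s`. -/
def cellIs {L : ℕ} (i : ZMod L) (s : Option (ZMod L)) : Set (State L) := {x | (x i).2 = s}

lemma visits_zero {L : ℕ} (i j : ZMod L) : visits i j 0 = 0 := by simp [visits]

lemma visits_succ {L : ℕ} (i j : ZMod L) (k : ℕ) :
    visits i j (k + 1) = visits i j k + if j + ((k + 1 : ℕ) : ZMod L) = i then 1 else 0 := by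
  unfold visits
  rw [← Finset.insert_Icc_right_eq_Icc_add_one (by omega), Finset.filter_insert]
  split_ifs with h
  · rw [Finset.card_insert_of_notMem (by simp)]
  · rfl

lemma visits_mono {L : ℕ} (i j : ZMod L) : Monotone (visits i j) :=
  monotone_nat_of_le_succ fun k => by rw [visits_succ]; exact Nat.le_add_right _ _

namespace Params

variable {L : ℕ} [NeZero L] (M : Params L)

section Stationary

variable {M} {m : PMF (State L)}

/-- The test function is the queue length truncated at `n`, since the queue length itself might have
infinite mean. An arrival raises it exactly when `restQueue` is below `n`, and an entry into the
ring lowers it exactly when the queue was at most `n`. -/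
lemma tsum_min_queue_balance (hm : Invariant M.transProb m) (i : ZMod L) (n : ℕ) :
    ENNReal.ofReal (M.p i) * ∑' x, {x | restQueue x i < n}.indicator m x =
      ∑' x, (entering i ∩ {x | (x i).1 ≤ n}).indicator m x := by
  have h := M.tsum_mul_of_invariant hm fun x => ((min (x i).1 n : ℕ) : ℝ≥0∞)
  have hstep : ∀ x : State L,
      ∫⁻ e, ((min (step x e i).1 n : ℕ) : ℝ≥0∞) ∂M.decisionLaw =
        ((min (restQueue x i) n : ℕ) : ℝ≥0∞) +
          {x | restQueue x i < n}.indicator (fun _ => ENNReal.ofReal (M.p i)) x := by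
    intro x
    have he : ∀ e : Decisions L, ((min (step x e i).1 n : ℕ) : ℝ≥0∞) =
        ((min (restQueue x i) n : ℕ) : ℝ≥0∞) +
          {x | restQueue x i < n}.indicator 1 x * {e : Decisions L | e i none = true}.indicator 1 e := by
      intro e
      have hs : (step x e i).1 = restQueue x i + if e i none then 1 else 0 := rfl
      rw [hs]
      by_cases hn : restQueue x i < n <;> by_cases hei : e i none = true
      · simp [hn, hei, min_eq_left hn.le]
      · simp [hei]
      · simp [hn, hei, min_eq_right (not_lt.1 hn), (not_lt.1 hn).trans (Nat.le_succ _)]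
      · simp [hei]
    simp_rw [he]
    rw [lintegral_add_left measurable_const, lintegral_const, measure_univ, mul_one,
      lintegral_const_mul _ (fun s _ => measurableSet_decisions _),
      lintegral_indicator_one (measurableSet_decisions _), decisionLaw_arrival]
    by_cases hn : restQueue x i < n <;> simp [hn]
  have hself : ∀ x : State L, ((min (x i).1 n : ℕ) : ℝ≥0∞) =
      ((min (restQueue x i) n : ℕ) : ℝ≥0∞) + (entering i ∩ {x | (x i).1 ≤ n}).indicator 1 x := by
    intro x
    by_cases hx : x ∈ entering i ∩ {x | (x i).1 ≤ n}
    · have h1 : restQueue x i + 1 = (x i).1 := by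
        rw [restQueue, if_pos hx.1.1]
        have := hx.1.2
        omega
      have h2 : (x i).1 ≤ n := hx.2
      rw [Set.indicator_of_mem hx, Pi.one_apply, min_eq_left h2, min_eq_left (by omega), ← h1]
      push_cast
      rfl
    · rw [Set.indicator_of_notMem hx, add_zero]
      -- Either no vehicle leaves the queue, or more than `n` were waiting and the truncated length
      -- stays `n`.
      congr 1
      simp only [entering, Set.mem_inter_iff, Set.mem_ofPred_eq, not_and, not_le] at hx
      unfold restQueue
      split_ifs with h0
      · rcases Nat.eq_zero_or_pos (x i).1 with hz | hz
        · simp [hz]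
        · have := hx ⟨h0, hz⟩
          omega
      · rfl
  simp_rw [hstep, hself, mul_add] at h
  rw [ENNReal.tsum_add, ENNReal.tsum_add] at h
  -- Truncation makes the term common to both sides at most `n`, so it can be cancelled in `ℝ≥0∞`.
  have hfin : ∑' x, m x * ((min (restQueue x i) n : ℕ) : ℝ≥0∞) ≠ ∞ := by
    refine ne_top_of_le_ne_top (b := (n : ℝ≥0∞)) (by simp) ?_
    calc _ ≤ ∑' x, m x * (n : ℝ≥0∞) := ENNReal.tsum_le_tsum fun x => by gcongr; exact min_le_right _ _
      _ = n := by rw [ENNReal.tsum_mul_right, m.tsum_coe, one_mul]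
  have h' := (ENNReal.add_right_inj hfin).1 h
  rw [← ENNReal.tsum_mul_left]
  refine Eq.trans (tsum_congr fun x => ?_) (h'.symm.trans (tsum_congr fun x => ?_))
  · by_cases hx : x ∈ {x | restQueue x i < n} <;> simp [hx, mul_comm]
  · by_cases hx : x ∈ entering i ∩ {x | (x i).1 ≤ n}
    · simp [Set.indicator_of_mem hx]
    · simp [Set.indicator_of_notMem hx]

/-- In a stationary regime the vehicles enter the ring from queue `i` at rate `p i`. -/
lemma tsum_entering (hm : Invariant M.transProb m) (i : ZMod L) :
    ∑' x, (entering i).indicator m x = ENNReal.ofReal (M.p i) := by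
  have h1 := PMF_tendsto_of_monotone m
    (A := fun n => (entering i ∩ {x | (x i).1 ≤ n} : Set (State L)))
    fun a b hab x hx => ⟨hx.1, le_trans hx.2 hab⟩
  have h2 := PMF_tendsto_of_monotone m (A := fun n => {x : State L | restQueue x i < n})
    fun a b hab x hx => lt_of_lt_of_le hx hab
  have e1 : (⋃ n : ℕ, entering i ∩ {x : State L | (x i).1 ≤ n}) = entering i := by
    ext x
    simp only [Set.mem_iUnion, Set.mem_inter_iff, Set.mem_ofPred_eq]
    exact ⟨fun ⟨_, h, _⟩ => h, fun h => ⟨_, h, le_rfl⟩⟩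
  have e2 : (⋃ n : ℕ, {x : State L | restQueue x i < n}) = Set.univ :=
    Set.eq_univ_of_forall fun x => Set.mem_iUnion.2 ⟨_, Nat.lt_succ_self _⟩
  rw [e1] at h1
  rw [e2, Set.indicator_univ, m.tsum_coe] at h2
  simp_rw [← tsum_min_queue_balance hm i] at h1
  have h3 := ENNReal.Tendsto.const_mul h2 (a := ENNReal.ofReal (M.p i)) (.inl one_ne_zero)
  rw [mul_one] at h3
  exact tendsto_nhds_unique h1 h3

/-- A type-`j` vehicle in cell `i + 1` either stayed on the ring when leaving cell `i`, or has just
entered from queue `i = j`; entries have probability `p j` by `tsum_entering`. -/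
lemma tsum_cellIs_succ (hm : Invariant M.transProb m) (i j : ZMod L) :
    ∑' x, (cellIs (i + 1) (some j)).indicator m x =
      (∑' x, (cellIs i (some j)).indicator m x) * ENNReal.ofReal (1 - M.q i j) +
        if i = j then ENNReal.ofReal (M.p j) else 0 := by
  have h := M.tsum_mul_of_invariant hm ((cellIs (i + 1) (some j)).indicator 1)
  have hstep : ∀ x : State L,
      ∫⁻ e, (cellIs (i + 1) (some j)).indicator 1 (step x e) ∂M.decisionLaw =
        (cellIs i (some j)).indicator 1 x * ENNReal.ofReal (1 - M.q i j) +
          if i = j then (entering i).indicator 1 x else 0 := by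
    intro x
    have he : ∀ e : Decisions L, (cellIs (i + 1) (some j)).indicator (1 : State L → ℝ≥0∞) (step x e) =
        (cellIs i (some j)).indicator 1 x *
          {e : Decisions L | e i (some j) = false}.indicator 1 e +
          if i = j then (entering i).indicator 1 x else 0 := by
      intro e
      simp only [Set.indicator_apply, cellIs, entering, Set.mem_ofPred_eq, step,
        add_sub_cancel_right, nextCell, Pi.one_apply]
      rcases hx : x i with ⟨n, _ | k⟩
      · by_cases hn : 0 < n <;> by_cases hij : i = j <;> simp [hn, hij]
      · by_cases hk : k = j
        · subst hk
          cases hek : e i (some k) <;> simp [hek]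
        · by_cases hek : e i (some k) <;> simp [hk, hek]
    simp_rw [he]
    rw [lintegral_add_right _ measurable_const,
      lintegral_const_mul _ (fun s _ => measurableSet_decisions _),
      lintegral_indicator_one (measurableSet_decisions _), decisionLaw_stay]
    simp
  simp_rw [hstep, mul_add] at h
  rw [ENNReal.tsum_add] at h
  have hind : ∀ (A : Set (State L)) x, m x * A.indicator 1 x = A.indicator m x := fun A x => by
    by_cases hx : x ∈ A <;> simp [hx]
  simp_rw [← mul_assoc, hind, ENNReal.tsum_mul_right] at h
  rw [h]
  congr 1
  split_ifs with hij
  · simp_rw [hind]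
    rw [tsum_entering hm i, hij]
  · simp

end Stationary

/-! ### Expected visits and the recursion around the ring -/

lemma hasSum_timeProb_tail (j : ZMod L) (n : ℕ) :
    HasSum (fun k => M.timeProb j (k + (n + 1))) (M.survProb j n) := by
  have h : ∀ n, ∑ k ∈ Finset.range (n + 1), M.timeProb j k = 1 - M.survProb j n := by
    intro n
    induction n with
    | zero => simp [timeProb, survProb_zero]
    | succ n ih => rw [Finset.sum_range_succ, ih, timeProb_succ]; ring
  have := (hasSum_nat_add_iff' (n + 1)).2 (M.hasSum_timeProb j)
  rwa [h, sub_sub_cancel] at this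

lemma summable_survProb_visit (i j : ZMod L) :
    Summable fun k : ℕ => M.survProb j k * if j + ((k + 1 : ℕ) : ZMod L) = i then (1 : ℝ) else 0 := by
  refine Summable.of_nonneg_of_le (fun k => ?_) (fun k => ?_) (M.summable_survProb j)
  · exact mul_nonneg (M.survProb_nonneg j k) (by split_ifs <;> simp)
  · exact mul_le_of_le_one_right (M.survProb_nonneg j k) (by split_ifs <;> simp)

/-- The expected number of visits as a sum over the visiting times. -/
lemma expectedVisits_eq_tsum (i j : ZMod L) :
    M.expectedVisits i j =
      ∑' k : ℕ, M.survProb j k * if j + ((k + 1 : ℕ) : ZMod L) = i then (1 : ℝ) else 0 := by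
  have hT : ∀ k, (M.timeLaw j k).toReal = M.timeProb j k := fun k =>
    ENNReal.toReal_ofReal (M.timeProb_nonneg j k)
  have hs := M.summable_expectedVisits i j
  unfold expectedVisits
  simp_rw [hT] at hs ⊢
  -- Summation by parts: `timeProb` is the decrement of `survProb`, and `visits` grows by the
  -- indicator of a visit.
  have habel : ∀ n, ∑ k ∈ Finset.range (n + 1), M.timeProb j k * (visits i j k : ℝ) =
      (∑ k ∈ Finset.range n, M.survProb j k *
        if j + ((k + 1 : ℕ) : ZMod L) = i then (1 : ℝ) else 0) -
        M.survProb j n * visits i j n := by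
    intro n
    induction n with
    | zero => simp [visits_zero]
    | succ n ih =>
      rw [Finset.sum_range_succ, ih, Finset.sum_range_succ _ n, timeProb_succ, visits_succ]
      push_cast
      ring
  -- Since `visits` is monotone, the boundary term is at most a tail of the convergent series for
  -- the expectation, hence tends to zero.
  have hbound : ∀ n, M.survProb j n * visits i j n ≤
      ∑' k, M.timeProb j (k + (n + 1)) * (visits i j (k + (n + 1)) : ℝ) := by
    intro n
    rw [← ((M.hasSum_timeProb_tail j n).mul_right _).tsum_eq]
    refine Summable.tsum_le_tsum (fun k => ?_) ((M.hasSum_timeProb_tail j n).mul_right _).summable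
      ((summable_nat_add_iff (n + 1)).2 hs)
    refine mul_le_mul_of_nonneg_left ?_ (M.timeProb_nonneg j _)
    exact_mod_cast visits_mono i j (by omega)
  have hzero : Tendsto (fun n => M.survProb j n * visits i j n) atTop (𝓝 0) :=
    squeeze_zero (fun n => mul_nonneg (M.survProb_nonneg j n) (Nat.cast_nonneg _)) hbound
      ((tendsto_sum_nat_add fun k => M.timeProb j k * (visits i j k : ℝ)).comp
        (tendsto_add_atTop_nat 1))
  have h1 := (tendsto_add_atTop_iff_nat 1).2 hs.hasSum.tendsto_sum_nat
  simp_rw [habel] at h1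
  have h2 := (M.summable_survProb_visit i j).hasSum.tendsto_sum_nat.sub hzero
  rw [sub_zero] at h2
  exact tendsto_nhds_unique h1 h2

/-- A visit to cell `i + 1` after the first time unit is a visit to cell `i` one unit earlier,
followed by a decision to stay. The initial term is the entry into cell `j + 1`, present only for `i
= j`. -/
lemma expectedVisits_succ (i j : ZMod L) :
    M.expectedVisits (i + 1) j =
      M.expectedVisits i j * (1 - M.q i j) + if i = j then 1 else 0 := by
  rw [expectedVisits_eq_tsum, (M.summable_survProb_visit (i + 1) j).tsum_eq_zero_add,
    expectedVisits_eq_tsum, ← tsum_mul_right, add_comm]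
  congr 1
  · refine tsum_congr fun k => ?_
    have hk : j + ((k + 1 + 1 : ℕ) : ZMod L) = i + 1 ↔ j + ((k + 1 : ℕ) : ZMod L) = i := by
      rw [Nat.cast_succ (k + 1), ← add_assoc, add_left_inj]
    simp only [hk, survProb_succ]
    split_ifs with h
    · rw [h]
      ring
    · simp
  · simp [survProb_zero, eq_comm]

/-- The balance equations of the vehicles of type `j` have at most one solution. -/
lemma eq_zero_of_succ_eq {j : ZMod L} {d : ZMod L → ℝ}
    (h : ∀ i, d (i + 1) = d i * (1 - M.q i j)) (i : ZMod L) : d i = 0 := by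
  have hn : ∀ n : ℕ, d (i + n) = d i * ∏ k ∈ Finset.range n, (1 - M.q (i + (k : ZMod L)) j) := by
    intro n
    induction n with
    | zero => simp
    | succ n ih =>
      rw [Nat.cast_succ, ← add_assoc, h, ih, Finset.prod_range_succ, mul_assoc]
  -- After `L` steps the index is back at `i`, so `d i` equals itself times a factor less than one.
  have hL := hn L
  rw [prod_range_zmod (fun x => 1 - M.q x j), ZMod.natCast_self, add_zero] at hL
  have h0 : d i * (1 - ∏ l, (1 - M.q l j)) = 0 := by linarith
  exact (mul_eq_zero.1 h0).resolve_right (sub_pos.2 (M.prod_stay_lt_one j)).ne'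

variable {M} in
lemma toReal_map_eq_load {m : PMF (State L)} (hm : Invariant M.transProb m) (i : ZMod L)
    (s : Option (ZMod L)) : (m.map (fun x => (x i).2) s).toReal = M.load i s := by
  have hmap : ∀ i s, m.map (fun x => (x i).2) s = ∑' x, (cellIs i s).indicator m x := by
    intro i s
    rw [PMF.map_apply]
    refine tsum_congr fun x => ?_
    simp only [Set.indicator_apply, cellIs, Set.mem_ofPred_eq, eq_comm (a := s)]
  have hsome : ∀ i j, (m.map (fun x => (x i).2) (some j)).toReal =
      M.expectedVisits i j * M.p j := by
    intro i j
    -- The cell probabilities and `b i j * p j` satisfy the same inhomogeneous recursion, so their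
    -- difference satisfies the homogeneous one.
    rw [← sub_eq_zero]
    refine M.eq_zero_of_succ_eq (j := j) (d := fun i =>
      (m.map (fun x => (x i).2) (some j)).toReal - M.expectedVisits i j * M.p j) (fun i => ?_) i
    have hne := (m.map (fun x => (x i).2)).apply_ne_top (some j)
    rw [hmap, tsum_cellIs_succ hm, ← hmap, expectedVisits_succ, ENNReal.toReal_add
      (ENNReal.mul_ne_top hne ENNReal.ofReal_ne_top) (by split_ifs <;> simp), ENNReal.toReal_mul,
      ENNReal.toReal_ofReal (sub_nonneg.2 (M.q_le_one i j))]
    split_ifs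
    · rw [ENNReal.toReal_ofReal (M.p_nonneg j)]
      ring
    · rw [ENNReal.toReal_zero]
      ring
  cases s with
  | some j => exact hsome i j
  | none =>
    have h := (m.map fun x => (x i).2).tsum_coe
    rw [tsum_fintype, Fintype.sum_option] at h
    have h' := congrArg ENNReal.toReal h
    rw [ENNReal.toReal_add (PMF.apply_ne_top _ _)
      (ENNReal.sum_ne_top.2 fun j _ => PMF.apply_ne_top _ _),
      ENNReal.toReal_sum fun j _ => PMF.apply_ne_top _ _, ENNReal.toReal_one] at h'
    simp_rw [hsome] at h'
    simp only [load]
    linarith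

end Params

end Roundabout

theorem mainTheorem6 (L : ℕ) [NeZero L] (M : Roundabout.Params L) (hM : M.IsStable) :
    (∃! μ : PMF (Roundabout.State L), M.IsStationary μ) ∧
      ∀ μ : PMF (Roundabout.State L), M.IsStationary μ →
        ∀ (i : ZMod L) (s : Option (ZMod L)),
          (μ.map (fun x => (x i).2) s).toReal = M.load i s :=
  ⟨M.existsUnique_stationary hM, fun _ hμ => Roundabout.Params.toReal_map_eq_load hμ⟩
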